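/- Let $d\ge 2$ and let $\Omega\subset\mathbb{R}^d$ be a non-empty, convex, bounded set that is equal to the closure of its interior. Write $\mathrm{vol}(A)$ for the Lebesgue measure and $\sigma(A)=\mathrm{vol}(A)^{-1}\int_A x\,\mathrm{d}x$ for the centroid of a set $A$. Let $\mathbf{v}=(v_1,\dots,v_n)\in(0,\infty)^n$ and $\mathbf{B}=(b_1,\dots,b_n)\in\Omega^n$ satisfy $$\sum_{i=1}^n v_i=\mathrm{vol}(\Omega),\qquad \sum_{i=1}^n v_i b_i=\mathrm{vol}(\Omega)\,\sigma(\Omega).$$ Let $\mathbb{D}_n$ be the set of all $\mathbf{X}=(x_1,\dots,x_n)\in(\mathbb{R}^d)^n=\mathbb{R}^{nd}$ with pairwise distinct entries. For $\mathbf{X}\in\mathbb{D}_n$ and $\mathbf{w}\in\mathbb{R}^n$ let $$\mathrm{Lag}_i(\mathbf{X},\mathbf{w})=\{x\in\Omega:\ |x-x_i|^2-w_i\le|x-x_j|^2-w_j\ \ \forall j\},$$ let $\mathbf{w}^*(\mathbf{X};\mathbf{v})$ be the unique maximiser with $w_n=0$ of the dual transport functional $$\mathbf{w}\mapsto\int_\Omega\min_i\big(|x-x_i|^2-w_i\big)\,\mathrm{d}x+\sum_{i=1}^n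 w_iv_i ,$$ and put $L_i(\mathbf{X};\mathbf{v})=\mathrm{Lag}_i(\mathbf{X},\mathbf{w}^*(\mathbf{X};\mathbf{v}))$ (these cells have volumes $v_i$) and $c_i(\mathbf{X};\mathbf{v})=\sigma(L_i(\mathbf{X};\mathbf{v}))$. Define $$f(\mathbf{X})=\sum_{i=1}^n v_i^2\,|c_i(\mathbf{X};\mathbf{v})-b_i|^2\qquad(\mathbf{X}\in\mathbb{D}_n),$$ $$H(\mathbf{X})=\tfrac12 W_2^2\Big(\mathcal{L}^d_\Omega,\sum_{i=1}^n v_i\delta_{x_i}\Big)-\tfrac12\sum_{i=1}^n v_i|x_i|^2+\sum_{i=1}^n v_i\,x_i\cdot b_i-\tfrac12\int_\Omega|x|^2\,\mathrm{d}x\qquad(\mathbf{X}\in\mathbb{R}^{nd}),$$ where $\mathcal{L}^d_\Omega$ is Lebesgue measure restricted to $\Omega$ and $W_2^2(\mathcal{L}^d_\Omega,\nu)$ is the infimum of $\int_\Omega|x-T(x)|^2\,\mathrm{d}x$ over all measurable maps $T$ that push $\mathcal{L}^d_\Omega$ forward to $\nu$. Suppose that no Laguerre diagram is compatible with $(\mathbf{v},\mathbf{B})$,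 that is, there is no $\mathbf{X}\in\mathbb{D}_n$ with $c_i(\mathbf{X};\mathbf{v})=b_i$ for all $i$. Fix $t\in\mathbb{R}^d$ and $R>0$, let $\mathbf{T}=(t,\dots,t)\in\mathbb{R}^{nd}$ and $B=\{\mathbf{X}\in\mathbb{R}^{nd}:|\mathbf{X}-\mathbf{T}|\le R\}$, and let $\mathbf{X}^*\in B$ be a global maximiser of $H$ on $B$. Assume that $\mathbf{X}^*\in\mathbb{D}_n$, that $H$ is three times continuously differentiable in a neighbourhood of $\mathbf{X}^*$, and that $\dim\ker D^2H(\mathbf{X}^*)=1+d$. Then $H$ is concave on $\mathbb{R}^{nd}$ (so that $\max_B H$ is a convex optimisation problem), and $\mathbf{X}^*$ is a local minimiser of $f$ on $\mathbb{D}_n$. -/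

import Mathlib

open MeasureTheory

noncomputable section

namespace LaguerreFit

/-- The Euclidean space of dimension `d`. -/
abbrev Pt (d : ℕ) : Type := EuclideanSpace ℝ (Fin d)

/-- Lists of `n` seeds, i.e. the Euclidean space of dimension `n * d`, whose norm satisfies
`‖X‖ ^ 2 = ∑ i, ‖X i‖ ^ 2`. -/
abbrev Seeds (n d : ℕ) : Type := PiLp 2 (fun _ : Fin n => Pt d)

/-- The diagonal point `(t, …, t)`. -/
def diag {d : ℕ} (n : ℕ) (t : Pt d) : Seeds n d := WithLp.toLp 2 (fun _ => t)

/-- The set of lists of pairwise distinct seeds. -/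
def distinctSeeds (n d : ℕ) : Set (Seeds n d) := {X | ∀ i j : Fin n, i ≠ j → X i ≠ X j}

/-- The domains under consideration: non-empty, convex, bounded sets that are equal to the closure
of their interior. -/
structure IsDomain {d : ℕ} (Ω : Set (Pt d)) : Prop where
  nonempty : Ω.Nonempty
  convex : Convex ℝ Ω
  bounded : Bornology.IsBounded Ω
  closure_interior : closure (interior Ω) = Ω

/-- The `i`-th Laguerre cell in `Ω` generated by the seeds `X` and the weights `w`. -/
def lagCell {n d : ℕ} (Ω : Set (Pt d)) (X : Seeds n d) (w : Fin n → ℝ) (i : Fin n) : Set (Pt d) :=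
  {x | x ∈ Ω ∧ ∀ j : Fin n, ‖x - X i‖ ^ 2 - w i ≤ ‖x - X j‖ ^ 2 - w j}

/-- The volume (Lebesgue measure) of a set. -/
def vol {d : ℕ} (A : Set (Pt d)) : ℝ := (volume A).toReal

/-- The centroid of a set of non-zero volume. -/
def centroid {d : ℕ} (A : Set (Pt d)) : Pt d := (vol A)⁻¹ • ∫ x in A, x

/-- The target measure: the sum of the Dirac masses at the seeds `X i` with masses `v i`. -/
def seedMeasure {n d : ℕ} (X : Seeds n d) (v : Fin n → ℝ) : Measure (Pt d) :=
  ∑ i, ENNReal.ofReal (v i) • Measure.dirac (X i)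

/-- `T` transports Lebesgue measure on `Ω` to the seed measure. For distinct seeds this says that
the set of points of `Ω` which `T` maps to `X i` has volume `v i`, for each `i`. -/
def IsAdmissible {n d : ℕ} (Ω : Set (Pt d)) (X : Seeds n d) (v : Fin n → ℝ) (T : Pt d → Pt d) :
    Prop :=
  Measurable T ∧ Measure.map T (volume.restrict Ω) = seedMeasure X v

/-- The quadratic cost of a transport map. -/
def transportCost {d : ℕ} (Ω : Set (Pt d)) (T : Pt d → Pt d) : ℝ := ∫ x in Ω, ‖x - T x‖ ^ 2

/-- The optimal cost of transporting Lebesgue measure on `Ω` to the seed measure. -/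
def optimalCost {n d : ℕ} (Ω : Set (Pt d)) (X : Seeds n d) (v : Fin n → ℝ) : ℝ :=
  sInf {c | ∃ T : Pt d → Pt d, IsAdmissible Ω X v T ∧ transportCost Ω T = c}

/-- The Wasserstein distance between Lebesgue measure on `Ω` and the seed measure. -/
def wasserstein {n d : ℕ} (Ω : Set (Pt d)) (X : Seeds n d) (v : Fin n → ℝ) : ℝ :=
  Real.sqrt (optimalCost Ω X v)

/-- The dual (Kantorovich) functional of the semi-discrete transport problem, as a function of the
weights. -/
def dualFunctional {n d : ℕ} (Ω : Set (Pt d)) (X : Seeds n d) (v w : Fin n → ℝ) : ℝ :=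
  (∫ x in Ω, ⨅ i : Fin n, (‖x - X i‖ ^ 2 - w i)) + ∑ i, w i * v i

/-- `w` is an optimal weight vector (it maximises the dual functional), normalised so that its last
entry is zero. -/
def IsOptimalWeight {n d : ℕ} (Ω : Set (Pt d)) (X : Seeds n d) (v w : Fin n → ℝ) : Prop :=
  (∀ w' : Fin n → ℝ, dualFunctional Ω X v w' ≤ dualFunctional Ω X v w) ∧
    ∀ i : Fin n, (i : ℕ) + 1 = n → w i = 0

open Classical in
/-- The normalised optimal weight vector. For distinct seeds it exists and is unique; the value `0`
is a default for the remaining cases. -/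
def optimalWeight {n d : ℕ} (Ω : Set (Pt d)) (X : Seeds n d) (v : Fin n → ℝ) : Fin n → ℝ :=
  if h : ∃ w : Fin n → ℝ, IsOptimalWeight Ω X v w then h.choose else 0

/-- The `i`-th cell of the Laguerre diagram with seeds `X` and cell volumes `v`. -/
def cell {n d : ℕ} (Ω : Set (Pt d)) (X : Seeds n d) (v : Fin n → ℝ) (i : Fin n) : Set (Pt d) :=
  lagCell Ω X (optimalWeight Ω X v) i

/-- The centroid of the `i`-th cell of the Laguerre diagram with seeds `X` and cell volumes `v`. -/
def cellCentroid {n d : ℕ} (Ω : Set (Pt d)) (X : Seeds n d) (v : Fin n → ℝ) (i : Fin n) : Pt d :=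
  centroid (cell Ω X v i)

/-- Admissible target data: positive volumes `v i` that add up to the volume of `Ω`, and centroids
`b i` in `Ω` whose weighted sum is the first moment of `Ω`. -/
structure IsData {n d : ℕ} (Ω : Set (Pt d)) (v : Fin n → ℝ) (b : Seeds n d) : Prop where
  pos : ∀ i, 0 < v i
  sum_vol : ∑ i, v i = vol Ω
  mem : ∀ i, b i ∈ Ω
  sum_moment : ∑ i, v i • b i = vol Ω • centroid Ω

/-- The Laguerre diagram with (distinct) seeds `X` and cell volumes `v` is compatible with the data:
its cells have the prescribed centroids. -/
def IsCompatible {n d : ℕ} (Ω : Set (Pt d)) (v : Fin n → ℝ) (b X : Seeds n d) : Prop :=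
  X ∈ distinctSeeds n d ∧ ∀ i, cellCentroid Ω X v i = b i

/-- The least squares centroid error. -/
def fitError {n d : ℕ} (Ω : Set (Pt d)) (v : Fin n → ℝ) (b X : Seeds n d) : ℝ :=
  ∑ i, v i ^ 2 * ‖cellCentroid Ω X v i - b i‖ ^ 2

/-- One half of the squared Wasserstein distance. -/
def F {n d : ℕ} (Ω : Set (Pt d)) (v : Fin n → ℝ) (X : Seeds n d) : ℝ :=
  1 / 2 * wasserstein Ω X v ^ 2

/-- The helper function `H`. -/
def H {n d : ℕ} (Ω : Set (Pt d)) (v : Fin n → ℝ) (b X : Seeds n d) : ℝ :=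
  F Ω v X - 1 / 2 * ∑ i, v i * ‖X i‖ ^ 2 + ∑ i, v i * inner ℝ (X i) (b i)
    - 1 / 2 * ∫ x in Ω, ‖x‖ ^ 2

/-- The Hessian of `g` at `X` as a linear operator: the derivative of the gradient. -/
def hessian {n d : ℕ} (g : Seeds n d → ℝ) (X : Seeds n d) : Seeds n d →L[ℝ] Seeds n d :=
  fderiv ℝ (gradient g) X

end LaguerreFit

end

/-!
A transport map to the seeds `Y` amounts to a splitting `B` of `Ω` into pieces of volumes `v i`
(`exists_isSplit_of_isAdmissible`, `IsSplit.exists_isAdmissible`). This also holds if some seeds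
coincide, because Lebesgue measure has no atoms. Expanding the square in the transport cost shows
that `H Y` is the infimum over all splittings of the linear functions
`∑ i, ⟪Y i, v i • b i - ∫ x in B i, x⟫` (`splitValue`). Hence `H` is concave and positively
homogeneous.

For distinct seeds `X` the infimum at `X` is attained by the optimal Laguerre diagram. Optimal
weights exist since the dual functional is continuous and coercive modulo constants, and their cells
have volumes `v i` by the first-order optimality condition (`isSplit_cell`). With
`G X = momentGap Ω v b X`, the vector of the `v i • (b i - c i)`, this gives
`H Y ≤ ⟪G X, Y⟫` for all `Y`, with equality for `Y = X`, as well as `fitError X = ‖G X‖ ^ 2`.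
Moreover `G X` is orthogonal to the diagonal, since the first moments match.

Let `X` maximise `H` on the ball of radius `R` about the diagonal point `T`. There `H` is
differentiable with gradient `G X`, and maximality gives `R * ‖G X‖ ≤ ⟪G X, X - T⟫ = H X`
(`mul_norm_momentGap_le`). For distinct seeds `Y` the supergradient inequality gives
`H X ≤ ⟪G Y, X⟫ = ⟪G Y, X - T⟫ ≤ R * ‖G Y‖`. Therefore `‖G X‖ ≤ ‖G Y‖`: the point `X` minimises the
fit error even globally. This is minimax duality: the `G Y` are supergradients of `H` at the origin,
and `G X` is the one of smallest norm.
-/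

noncomputable section

namespace LaguerreFit

open Set Filter Topology Function

variable {n d : ℕ} {Ω : Set (Pt d)} {v : Fin n → ℝ} {b : Seeds n d}

/-! ### The domain -/

lemma IsDomain.isClosed (hΩ : IsDomain Ω) : IsClosed Ω := by
  rw [← hΩ.closure_interior]; exact isClosed_closure

lemma IsDomain.isCompact (hΩ : IsDomain Ω) : IsCompact Ω :=
  Metric.isCompact_of_isClosed_isBounded hΩ.isClosed hΩ.bounded

lemma IsDomain.measurableSet (hΩ : IsDomain Ω) : MeasurableSet Ω := hΩ.isClosed.measurableSet

lemma IsDomain.volume_ne_top (hΩ : IsDomain Ω) : volume Ω ≠ ⊤ := hΩ.isCompact.measure_ne_top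

lemma IsDomain.vol_pos (hΩ : IsDomain Ω) : 0 < vol Ω := by
  have h : (interior Ω).Nonempty := by
    rw [← closure_nonempty_iff, hΩ.closure_interior]; exact hΩ.nonempty
  exact ENNReal.toReal_pos (Measure.measure_pos_of_nonempty_interior volume h).ne' hΩ.volume_ne_top

lemma IsDomain.integrableOn (hΩ : IsDomain Ω) {E : Type*} [NormedAddCommGroup E]
    {f : Pt d → E} (hf : Continuous f) : IntegrableOn f Ω :=
  hf.continuousOn.integrableOn_compact hΩ.isCompact

/-! ### Splitting a set into pieces of prescribed volumes -/

/-- Lebesgue measure has no atoms, so intermediate volumes are attained: the volume of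
`A ∩ closedBall 0 r` depends continuously on `r`. -/
lemma exists_subset_vol_eq (hd : 0 < d) {A : Set (Pt d)} (hA : MeasurableSet A)
    (hb : Bornology.IsBounded A) {c : ℝ} (hc : 0 ≤ c) (hcA : ENNReal.ofReal c ≤ volume A) :
    ∃ B ⊆ A, MeasurableSet B ∧ volume B = ENNReal.ofReal c := by
  have : Nonempty (Fin d) := ⟨⟨0, hd⟩⟩
  obtain ⟨r, hr⟩ := hb.subset_closedBall (0 : Pt d)
  have hfin : volume A ≠ ⊤ := hb.measure_lt_top.ne
  have : IsFiniteMeasure (volume.restrict A) := ⟨by simpa using hfin.lt_top⟩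
  have hms : ∀ s : ℝ, MeasurableSet (Metric.closedBall (0 : Pt d) s) :=
    fun s => Metric.isClosed_closedBall.measurableSet
  set g : ℝ → ℝ := fun s => ∫ x in A, (Metric.closedBall (0 : Pt d) s).indicator 1 x with hg
  have hgv : ∀ s, g s = (volume (Metric.closedBall 0 s ∩ A)).toReal := by
    intro s
    simp only [hg]
    rw [integral_indicator_one (hms s), measureReal_restrict_apply (hms s)]
    rfl
  have hcont : Continuous g := by
    rw [continuous_iff_continuousAt]
    intro s₀
    refine continuousAt_of_dominated (bound := fun _ => 1) ?_ ?_ (integrable_const _) ?_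
    · exact .of_forall fun s => (measurable_one.indicator (hms s)).aestronglyMeasurable
    · refine .of_forall fun s => .of_forall fun x => ?_
      by_cases h : x ∈ Metric.closedBall (0 : Pt d) s <;> simp [h]
    · have h0 : ∀ᵐ x : Pt d ∂volume, x ∉ Metric.sphere (0 : Pt d) s₀ :=
        measure_eq_zero_iff_ae_notMem.1 (Measure.addHaar_sphere _ _ _)
      filter_upwards [ae_restrict_of_ae h0] with x hx
      rw [mem_sphere_zero_iff_norm] at hx
      rcases lt_or_gt_of_ne hx with h | h
      · refine (continuousAt_const (y := (1 : ℝ))).congr ?_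
        filter_upwards [lt_mem_nhds h] with s hs
        simp [indicator, hs.le]
      · refine (continuousAt_const (y := (0 : ℝ))).congr ?_
        filter_upwards [gt_mem_nhds h] with s hs
        simp [indicator, not_le.2 hs]
  have hlow : g (min (-1) r) = 0 := by
    rw [hgv, Metric.closedBall_eq_empty.2 (lt_of_le_of_lt (min_le_left _ _) (by norm_num))]
    simp
  have hhigh : g r = (volume A).toReal := by
    rw [hgv, inter_eq_self_of_subset_right hr]
  have hmem : c ∈ Icc (g (min (-1) r)) (g r) := by
    rw [hlow, hhigh]
    exact ⟨hc, (ENNReal.ofReal_le_iff_le_toReal hfin).1 hcA⟩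
  obtain ⟨s, -, hs⟩ := intermediate_value_Icc (min_le_right _ _) hcont.continuousOn hmem
  refine ⟨Metric.closedBall 0 s ∩ A, inter_subset_right, (hms s).inter hA, ?_⟩
  rw [← hs, hgv, ENNReal.ofReal_toReal]
  exact measure_ne_top_of_subset inter_subset_right hfin

lemma exists_pairwiseDisjoint_vol_eq (hd : 0 < d) {ι : Type*} [DecidableEq ι] {v : ι → ℝ}
    (hv : ∀ i, 0 ≤ v i) (S : Finset ι) : ∀ {A : Set (Pt d)}, MeasurableSet A →
    Bornology.IsBounded A → volume A = ∑ i ∈ S, ENNReal.ofReal (v i) →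
    ∃ B : ι → Set (Pt d), (∀ i, MeasurableSet (B i)) ∧ (∀ i, B i ⊆ A) ∧
      (∀ i ∈ S, volume (B i) = ENNReal.ofReal (v i)) ∧ Pairwise (Disjoint on B) := by
  induction S using Finset.induction_on with
  | empty =>
    intro A _ _ _
    exact ⟨fun _ => ∅, by simp, by simp, by simp, fun i j _ => by simp [onFun]⟩
  | insert a S ha ih =>
    intro A hA hb hvol
    rw [Finset.sum_insert ha] at hvol
    obtain ⟨C, hCA, hC, hCv⟩ := exists_subset_vol_eq hd hA hb (hv a) (hvol ▸ le_self_add)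
    have hdiff : volume (A \ C) = ∑ i ∈ S, ENNReal.ofReal (v i) := by
      rw [measure_sdiff hCA hC.nullMeasurableSet (by simp [hCv]), hvol, hCv]
      exact ENNReal.add_sub_cancel_left ENNReal.ofReal_ne_top
    obtain ⟨B, hB, hBA, hBv, hBd⟩ := ih (hA.diff hC) (hb.subset sdiff_subset) hdiff
    have hCB : ∀ i, Disjoint C (B i) := fun i =>
      (disjoint_sdiff_right (s := C) (t := A)).mono_right (hBA i)
    refine ⟨update B a C, fun i => ?_, fun i => ?_, fun i hi => ?_, fun i j hij => ?_⟩
    · by_cases h : i = a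
      · subst h; simpa using hC
      · simpa [h] using hB i
    · by_cases h : i = a
      · subst h; simpa using hCA
      · simpa [h] using (hBA i).trans sdiff_subset
    · by_cases h : i = a
      · subst h; simpa using hCv
      · simpa [h] using hBv i (Finset.mem_of_mem_insert_of_ne hi h)
    · simp only [onFun]
      by_cases h : i = a
      · subst h; simpa [hij.symm] using hCB j
      · by_cases h' : j = a
        · subst h'; simpa [h] using (hCB i).symm
        · simpa [h, h'] using hBd hij

/-- `B` splits `Ω`, up to null sets, into measurable pieces with volumes `v i`. The pieces may
overlap in null sets, as Laguerre cells do. -/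
structure IsSplit (Ω : Set (Pt d)) (v : Fin n → ℝ) (B : Fin n → Set (Pt d)) : Prop where
  measurableSet : ∀ i, MeasurableSet (B i)
  subset : ∀ i, B i ⊆ Ω
  aedisjoint : Pairwise (AEDisjoint volume on B)
  volume_eq : ∀ i, volume (B i) = ENNReal.ofReal (v i)

/-- The transport maps to the seeds `Y` come from splittings of `Ω`. If some seeds coincide, the
preimage of their common position has to be split further. -/
lemma exists_isSplit_of_isAdmissible (hd : 0 < d) (hΩ : IsDomain Ω) (hv : ∀ i, 0 ≤ v i)
    {Y : Seeds n d} {T : Pt d → Pt d} (hT : IsAdmissible Ω Y v T) :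
    ∃ B, IsSplit Ω v B ∧ ∀ i, ∀ x ∈ B i, T x = Y i := by
  classical
  have hA : ∀ c, MeasurableSet (T ⁻¹' {c} ∩ Ω) := fun c =>
    (hT.1 (measurableSet_singleton c)).inter hΩ.measurableSet
  have hvol : ∀ c, volume (T ⁻¹' {c} ∩ Ω) =
      ∑ i ∈ Finset.univ.filter (fun i => Y i = c), ENNReal.ofReal (v i) := by
    intro c
    have h := congrArg (fun μ : Measure (Pt d) => μ {c}) hT.2
    simp only [Measure.map_apply hT.1 (measurableSet_singleton c),
      Measure.restrict_apply (hT.1 (measurableSet_singleton c)), seedMeasure,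
      Measure.coe_finsetSum, Finset.sum_apply, Measure.smul_apply,
      Measure.dirac_apply' _ (measurableSet_singleton c), smul_eq_mul] at h
    rw [h, Finset.sum_filter]
    refine Finset.sum_congr rfl fun i _ => ?_
    by_cases hi : Y i = c <;> simp [hi]
  choose B hB hBA hBv hBd using fun c =>
    exists_pairwiseDisjoint_vol_eq hd hv _ (hA c) (hΩ.bounded.subset inter_subset_right) (hvol c)
  refine ⟨fun i => B (Y i) i, ⟨fun i => hB _ _, fun i => (hBA _ _).trans inter_subset_right,
    fun i j hij => ?_, fun i => hBv _ _ (by simp)⟩, fun i x hx => (hBA _ _ hx).1⟩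
  refine Disjoint.aedisjoint ?_
  change Disjoint (B (Y i) i) (B (Y j) j)
  by_cases h : Y i = Y j
  · rw [h]; exact hBd _ hij
  · refine Set.disjoint_left.2 fun x hx hx' => h ?_
    exact ((hBA _ _ hx).1 : T x = Y i).symm.trans (hBA _ _ hx').1

lemma IsSplit.iUnion_ae_eq (hΩ : IsDomain Ω) (hdata : IsData Ω v b) {B : Fin n → Set (Pt d)}
    (hB : IsSplit Ω v B) : (⋃ i, B i : Set (Pt d)) =ᵐ[volume] Ω := by
  refine ae_eq_of_subset_of_measure_ge (iUnion_subset hB.subset) ?_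
    (MeasurableSet.iUnion hB.measurableSet).nullMeasurableSet hΩ.volume_ne_top
  rw [measure_iUnion₀ hB.aedisjoint fun i => (hB.measurableSet i).nullMeasurableSet, tsum_fintype]
  simp only [hB.volume_eq]
  rw [← ENNReal.ofReal_sum_of_nonneg fun i _ => (hdata.pos i).le, hdata.sum_vol, vol,
    ENNReal.ofReal_toReal hΩ.volume_ne_top]

lemma IsSplit.integral_eq (hΩ : IsDomain Ω) (hdata : IsData Ω v b) {B : Fin n → Set (Pt d)}
    (hB : IsSplit Ω v B) {E : Type*} [NormedAddCommGroup E] [NormedSpace ℝ E] {f : Pt d → E}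
    (hf : IntegrableOn f Ω) : ∫ x in Ω, f x = ∑ i, ∫ x in B i, f x := by
  rw [← setIntegral_congr_set (hB.iUnion_ae_eq hΩ hdata), integral_iUnion_ae
    (fun i => (hB.measurableSet i).nullMeasurableSet) hB.aedisjoint
    (hf.mono_set (iUnion_subset hB.subset)), tsum_fintype]

lemma IsSplit.measureReal_eq (hdata : IsData Ω v b) {B : Fin n → Set (Pt d)}
    (hB : IsSplit Ω v B) (i : Fin n) : volume.real (B i) = v i := by
  rw [measureReal_def, hB.volume_eq, ENNReal.toReal_ofReal (hdata.pos i).le]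

/-- Every splitting comes from a transport map. -/
lemma IsSplit.exists_isAdmissible (hΩ : IsDomain Ω) (hdata : IsData Ω v b)
    {B : Fin n → Set (Pt d)} (hB : IsSplit Ω v B) (Y : Seeds n d) :
    ∃ T, IsAdmissible Ω Y v T ∧ ∀ i, ∀ᵐ x ∂volume.restrict (B i), T x = Y i := by
  classical
  obtain ⟨N, hN, hN0, hNd⟩ := exists_null_pairwise_disjoint_sdiff hB.aedisjoint
  set T : Pt d → Pt d := fun x => ∑ i, (B i \ N i).indicator (fun _ => Y i) x with hTdef
  have hTm : Measurable T := Finset.measurable_fun_sum _ fun i _ =>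
    measurable_const.indicator ((hB.measurableSet i).diff (hN i))
  have hTae : ∀ i, ∀ᵐ x ∂volume.restrict (B i), T x = Y i := by
    intro i
    filter_upwards [ae_restrict_mem (hB.measurableSet i),
      ae_restrict_of_ae (measure_eq_zero_iff_ae_notMem.1 (hN0 i))] with x hx hxN
    simp only [hTdef]
    rw [Finset.sum_eq_single i]
    · exact indicator_of_mem (show x ∈ B i \ N i from ⟨hx, hxN⟩) _
    · intro j _ hji
      refine indicator_of_notMem (fun hj => ?_) _
      exact Set.disjoint_left.1 (hNd hji) hj ⟨hx, hxN⟩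
    · simp
  refine ⟨T, ⟨hTm, ?_⟩, hTae⟩
  rw [← Measure.restrict_congr_set (hB.iUnion_ae_eq hΩ hdata), Measure.restrict_iUnion_ae
    hB.aedisjoint fun i => (hB.measurableSet i).nullMeasurableSet, Measure.map_sum
    hTm.aemeasurable, seedMeasure, Measure.sum_fintype]
  refine Finset.sum_congr rfl fun i _ => ?_
  rw [Measure.map_congr (hTae i), Measure.map_const, Measure.restrict_apply_univ, hB.volume_eq]

/-! ### The cost of a splitting -/

/-- The value at the seeds `Y` of the linear function that the splitting `B` contributes to the
infimum defining `H`. -/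
def splitValue (v : Fin n → ℝ) (b : Seeds n d) (B : Fin n → Set (Pt d)) (Y : Seeds n d) : ℝ :=
  ∑ i, inner ℝ (Y i) (v i • b i - ∫ x in B i, x)

lemma sum_integral_eq (hΩ : IsDomain Ω) (hdata : IsData Ω v b)
    {B : Fin n → Set (Pt d)} (hB : IsSplit Ω v B) (Y : Seeds n d) :
    ∑ i, ∫ x in B i, ‖x - Y i‖ ^ 2 =
      (∫ x in Ω, ‖x‖ ^ 2) + ∑ i, v i * ‖Y i‖ ^ 2 - 2 * ∑ i, inner ℝ (Y i) (∫ x in B i, x) := by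
  rw [hB.integral_eq hΩ hdata (hΩ.integrableOn (by fun_prop)), Finset.mul_sum,
    ← Finset.sum_add_distrib, ← Finset.sum_sub_distrib]
  refine Finset.sum_congr rfl fun i _ => ?_
  have hI : ∀ {E : Type} [NormedAddCommGroup E] {f : Pt d → E}, Continuous f →
      Integrable f (volume.restrict (B i)) :=
    fun hf => (hΩ.integrableOn hf).mono_set (hB.subset i)
  have hfin : IsFiniteMeasure (volume.restrict (B i)) := ⟨by simp [hB.volume_eq]⟩
  simp only [norm_sub_sq_real]
  rw [integral_add (hI (by fun_prop)) (integrable_const _),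
    integral_sub (hI (by fun_prop)) (hI (by fun_prop)), integral_const, integral_const_mul]
  simp_rw [real_inner_comm (Y i)]
  rw [integral_inner (f := fun x => x) (hI continuous_id) (Y i), measureReal_restrict_apply_univ,
    hB.measureReal_eq hdata, smul_eq_mul]
  ring

lemma transportCost_eq (hΩ : IsDomain Ω) (hdata : IsData Ω v b)
    {B : Fin n → Set (Pt d)} (hB : IsSplit Ω v B) {Y : Seeds n d} {T : Pt d → Pt d}
    (hT : ∀ i, ∀ᵐ x ∂volume.restrict (B i), T x = Y i) :
    transportCost Ω T = ∑ i, ∫ x in B i, ‖x - Y i‖ ^ 2 := by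
  have hcongr : ∀ i, (fun x => ‖x - T x‖ ^ 2) =ᵐ[volume.restrict (B i)]
      fun x => ‖x - Y i‖ ^ 2 := fun i => by
    filter_upwards [hT i] with x hx
    rw [hx]
  have hint : IntegrableOn (fun x => ‖x - T x‖ ^ 2) Ω := by
    rw [← integrableOn_congr_set_ae (hB.iUnion_ae_eq hΩ hdata), integrableOn_finite_iUnion]
    intro i
    refine Integrable.congr ?_ (hcongr i).symm
    exact (hΩ.integrableOn (f := fun x => ‖x - Y i‖ ^ 2) (by fun_prop)).mono_set (hB.subset i)
  rw [transportCost, hB.integral_eq hΩ hdata hint]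
  exact Finset.sum_congr rfl fun i _ => integral_congr_ae (hcongr i)

lemma transportCost_eq_splitValue (hΩ : IsDomain Ω) (hdata : IsData Ω v b)
    {B : Fin n → Set (Pt d)} (hB : IsSplit Ω v B) {Y : Seeds n d} {T : Pt d → Pt d}
    (hT : ∀ i, ∀ᵐ x ∂volume.restrict (B i), T x = Y i) :
    1 / 2 * transportCost Ω T - 1 / 2 * ∑ i, v i * ‖Y i‖ ^ 2 + ∑ i, v i * inner ℝ (Y i) (b i)
      - 1 / 2 * ∫ x in Ω, ‖x‖ ^ 2 = splitValue v b B Y := by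
  rw [transportCost_eq hΩ hdata hB hT, sum_integral_eq hΩ hdata hB, splitValue]
  simp only [inner_sub_right, Finset.sum_sub_distrib, inner_smul_right]
  ring

lemma transportCost_nonneg (T : Pt d → Pt d) : 0 ≤ transportCost Ω T :=
  integral_nonneg fun _ => by positivity

lemma H_eq (Y : Seeds n d) : H Ω v b Y = 1 / 2 * optimalCost Ω Y v
    - 1 / 2 * ∑ i, v i * ‖Y i‖ ^ 2 + ∑ i, v i * inner ℝ (Y i) (b i)
      - 1 / 2 * ∫ x in Ω, ‖x‖ ^ 2 := by
  have h0 : 0 ≤ optimalCost Ω Y v := by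
    refine Real.sInf_nonneg ?_
    rintro _ ⟨T, -, rfl⟩
    exact transportCost_nonneg T
  rw [H, F, wasserstein, Real.sq_sqrt h0]

lemma H_le_splitValue (hΩ : IsDomain Ω) (hdata : IsData Ω v b)
    {B : Fin n → Set (Pt d)} (hB : IsSplit Ω v B) (Y : Seeds n d) :
    H Ω v b Y ≤ splitValue v b B Y := by
  obtain ⟨T, hT, hTB⟩ := hB.exists_isAdmissible hΩ hdata Y
  have h : optimalCost Ω Y v ≤ transportCost Ω T := by
    refine csInf_le ⟨0, ?_⟩ ⟨T, hT, rfl⟩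
    rintro _ ⟨T, -, rfl⟩
    exact transportCost_nonneg T
  rw [← transportCost_eq_splitValue hΩ hdata hB hTB, H_eq]
  linarith

lemma exists_isSplit (hd : 0 < d) (hΩ : IsDomain Ω) (hdata : IsData Ω v b) :
    ∃ B, IsSplit Ω v B := by
  obtain ⟨B, h1, h2, h3, h4⟩ := exists_pairwiseDisjoint_vol_eq hd (fun i => (hdata.pos i).le)
    Finset.univ hΩ.measurableSet hΩ.bounded (by
      rw [← ENNReal.ofReal_sum_of_nonneg fun i _ => (hdata.pos i).le, hdata.sum_vol, vol,
        ENNReal.ofReal_toReal hΩ.volume_ne_top])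
  exact ⟨B, h1, h2, fun i j hij => (h4 hij).aedisjoint, fun i => h3 i (Finset.mem_univ i)⟩

lemma le_H_of_forall_le_splitValue (hd : 0 < d) (hΩ : IsDomain Ω) (hdata : IsData Ω v b)
    {Y : Seeds n d} {c : ℝ} (hc : ∀ B, IsSplit Ω v B → c ≤ splitValue v b B Y) :
    c ≤ H Ω v b Y := by
  set K := - (1 / 2 * ∑ i, v i * ‖Y i‖ ^ 2) + ∑ i, v i * inner ℝ (Y i) (b i)
      - 1 / 2 * ∫ x in Ω, ‖x‖ ^ 2 with hK
  have h : 2 * (c - K) ≤ optimalCost Ω Y v := by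
    refine le_csInf ?_ ?_
    · obtain ⟨B, hB⟩ := exists_isSplit hd hΩ hdata
      obtain ⟨T, hT, -⟩ := hB.exists_isAdmissible hΩ hdata Y
      exact ⟨_, T, hT, rfl⟩
    · rintro _ ⟨T, hT, rfl⟩
      obtain ⟨B, hB, hTB⟩ := exists_isSplit_of_isAdmissible hd hΩ (fun i => (hdata.pos i).le) hT
      have h1 := transportCost_eq_splitValue hΩ hdata hB fun i =>
        (ae_restrict_mem (hB.measurableSet i)).mono (hTB i)
      have h2 := hc B hB
      linarith
  rw [H_eq]
  linarith

/-- `H` is concave, as the infimum of the linear functions given by the splittings of `Ω`. -/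
lemma concaveOn_H (hd : 0 < d) (hΩ : IsDomain Ω) (hdata : IsData Ω v b) :
    ConcaveOn ℝ univ (H Ω v b) := by
  refine ⟨convex_univ, fun Y _ Z _ p q hp hq _ => ?_⟩
  refine le_H_of_forall_le_splitValue hd hΩ hdata fun B hB => ?_
  have h : splitValue v b B (p • Y + q • Z) =
      p * splitValue v b B Y + q * splitValue v b B Z := by
    simp [splitValue, inner_add_left, inner_smul_left, Finset.sum_add_distrib, Finset.mul_sum]
  rw [h, smul_eq_mul, smul_eq_mul]
  gcongr
  · exact H_le_splitValue hΩ hdata hB Y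
  · exact H_le_splitValue hΩ hdata hB Z

/-! ### Existence of optimal weights -/

lemma IsData.nonempty (hΩ : IsDomain Ω) (hdata : IsData Ω v b) : Nonempty (Fin n) := by
  by_contra h
  rw [not_nonempty_iff] at h
  have := hdata.sum_vol
  rw [Finset.univ_eq_empty, Finset.sum_empty] at this
  exact hΩ.vol_pos.ne this

/-- The smallest power distance of `x` to the seeds. -/
def minPower (X : Seeds n d) (w : Fin n → ℝ) (x : Pt d) : ℝ := ⨅ i, (‖x - X i‖ ^ 2 - w i)

lemma minPower_le (X : Seeds n d) (w : Fin n → ℝ) (x : Pt d) (i : Fin n) :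
    minPower X w x ≤ ‖x - X i‖ ^ 2 - w i :=
  ciInf_le (finite_range _).bddBelow i

lemma le_minPower [Nonempty (Fin n)] {X : Seeds n d} {w : Fin n → ℝ} {x : Pt d} {c : ℝ}
    (h : ∀ i, c ≤ ‖x - X i‖ ^ 2 - w i) : c ≤ minPower X w x :=
  le_ciInf h

lemma exists_minPower_eq [Nonempty (Fin n)] (X : Seeds n d) (w : Fin n → ℝ) (x : Pt d) :
    ∃ i, ‖x - X i‖ ^ 2 - w i = minPower X w x :=
  exists_eq_ciInf_of_finite

lemma mem_lagCell_iff [Nonempty (Fin n)] {X : Seeds n d} {w : Fin n → ℝ} {x : Pt d} {i : Fin n} :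
    x ∈ lagCell Ω X w i ↔ x ∈ Ω ∧ ‖x - X i‖ ^ 2 - w i = minPower X w x := by
  refine and_congr_right fun _ => ⟨fun h => ?_, fun h j => h ▸ minPower_le X w x j⟩
  exact le_antisymm (le_minPower h) (minPower_le X w x i)

lemma continuous_uncurry_minPower [Nonempty (Fin n)] (X : Seeds n d) :
    Continuous (uncurry (minPower X)) := by
  have : uncurry (minPower X) = fun p : (Fin n → ℝ) × Pt d =>
      Finset.univ.inf' Finset.univ_nonempty fun i => ‖p.2 - X i‖ ^ 2 - p.1 i := by
    ext p
    rw [Finset.inf'_univ_eq_ciInf]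
    rfl
  rw [this]
  exact Continuous.finset_inf'_apply _ fun i _ => by fun_prop

lemma continuous_minPower [Nonempty (Fin n)] (X : Seeds n d) (w : Fin n → ℝ) :
    Continuous (minPower X w) := by
  have h : minPower X w = uncurry (minPower X) ∘ Prod.mk w := rfl
  rw [h]
  exact (continuous_uncurry_minPower X).comp (by fun_prop)

lemma dualFunctional_eq (X : Seeds n d) (w : Fin n → ℝ) :
    dualFunctional Ω X v w = (∫ x in Ω, minPower X w x) + ∑ i, w i * v i := rfl

lemma continuous_dualFunctional [Nonempty (Fin n)] (hΩ : IsDomain Ω) (X : Seeds n d) :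
    Continuous (dualFunctional Ω X v) := by
  have h : Continuous fun w => ∫ x in Ω, minPower X w x :=
    continuous_parametric_integral_of_continuous (continuous_uncurry_minPower X) hΩ.isCompact
  exact h.add (by fun_prop)

lemma setIntegral_const_eq_vol (c : ℝ) : ∫ _ in Ω, c = vol Ω * c := by
  rw [setIntegral_const, smul_eq_mul]; rfl

/-- The dual functional is invariant under adding a constant to all weights. -/
lemma dualFunctional_sub_const [Nonempty (Fin n)] (hΩ : IsDomain Ω) (hdata : IsData Ω v b)
    (X : Seeds n d) (w : Fin n → ℝ) (c : ℝ) :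
    dualFunctional Ω X v (fun i => w i - c) = dualFunctional Ω X v w := by
  have h : ∀ x, minPower X (fun i => w i - c) x = minPower X w x + c := by
    intro x
    refine le_antisymm ?_ (le_minPower fun i => ?_)
    · obtain ⟨i, hi⟩ := exists_minPower_eq X w x
      have := minPower_le X (fun i => w i - c) x i
      linarith
    · have := minPower_le X w x i
      linarith
  simp only [dualFunctional_eq, h]
  have hc : IntegrableOn (fun _ : Pt d => c) Ω := hΩ.integrableOn continuous_const
  rw [integral_add (hΩ.integrableOn (continuous_minPower X w)) hc, setIntegral_const_eq_vol,
    ← hdata.sum_vol, Finset.sum_mul, add_assoc, ← Finset.sum_add_distrib]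
  congr 1
  exact Finset.sum_congr rfl fun i _ => by ring

/-- Superlevel sets of the dual functional are bounded modulo constants: the largest weight `w k`
bounds the integrand by `M - w k`, which leaves `- ∑ i, v i * (w k - w i)`, up to a constant. -/
lemma exists_bound_weights [Nonempty (Fin n)] (hΩ : IsDomain Ω) (hdata : IsData Ω v b)
    (X : Seeds n d) (l : Fin n) : ∃ C : ℝ, ∀ w : Fin n → ℝ, w l = 0 →
      dualFunctional Ω X v 0 ≤ dualFunctional Ω X v w → ∀ i, |w i| ≤ C := by
  have hM : ∃ M : ℝ, ∀ x ∈ Ω, ∀ i, ‖x - X i‖ ^ 2 ≤ M := by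
    have h : ∀ i, ∃ M : ℝ, ∀ x ∈ Ω, ‖x - X i‖ ^ 2 ≤ M := fun i => by
      obtain ⟨M, hM⟩ := hΩ.isCompact.bddAbove_image
        (f := fun x => ‖x - X i‖ ^ 2) (by fun_prop)
      exact ⟨M, fun x hx => hM (mem_image_of_mem _ hx)⟩
    choose M hM using h
    exact ⟨Finset.univ.sup' Finset.univ_nonempty M, fun x hx i =>
      (hM i x hx).trans (Finset.le_sup' M (Finset.mem_univ i))⟩
  obtain ⟨M, hM⟩ := hM
  obtain ⟨i₀, hi₀⟩ := Finite.exists_min v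
  refine ⟨vol Ω * M / v i₀, fun w hwl hw => ?_⟩
  obtain ⟨k, hk⟩ := Finite.exists_max w
  have h0 : 0 ≤ dualFunctional Ω X v 0 := by
    rw [dualFunctional_eq]
    simp only [Pi.zero_apply, zero_mul, Finset.sum_const_zero, add_zero]
    exact integral_nonneg fun x => le_minPower fun i => by simp
  have h1 : ∫ x in Ω, minPower X w x ≤ vol Ω * (M - w k) := by
    rw [← setIntegral_const_eq_vol]
    refine setIntegral_mono_on (hΩ.integrableOn (continuous_minPower X w))
      (hΩ.integrableOn continuous_const) hΩ.measurableSet fun x hx => ?_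
    exact (minPower_le X w x k).trans (sub_le_sub_right (hM x hx k) _)
  have h2 : ∑ i, v i * (w k - w i) ≤ vol Ω * M := by
    have h3 : ∑ i, v i * (w k - w i) = vol Ω * w k - ∑ i, w i * v i := by
      rw [← hdata.sum_vol, Finset.sum_mul, ← Finset.sum_sub_distrib]
      exact Finset.sum_congr rfl fun i _ => by ring
    rw [dualFunctional_eq X w] at hw
    linarith
  have h4 : ∀ j, w k - w j ≤ vol Ω * M / v i₀ := by
    intro j
    rw [le_div_iff₀ (hdata.pos i₀), mul_comm]
    calc v i₀ * (w k - w j) ≤ v j * (w k - w j) :=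
          mul_le_mul_of_nonneg_right (hi₀ j) (sub_nonneg.2 (hk j))
      _ ≤ ∑ i, v i * (w k - w i) := Finset.single_le_sum (f := fun i => v i * (w k - w i))
          (fun i _ => mul_nonneg (hdata.pos i).le (sub_nonneg.2 (hk i))) (Finset.mem_univ j)
      _ ≤ _ := h2
  intro j
  have h5 := h4 l
  have h6 := h4 j
  have h7 := hk l
  have h8 := hk j
  rw [abs_le]
  constructor <;> linarith

lemma exists_isOptimalWeight (hΩ : IsDomain Ω) (hdata : IsData Ω v b) (X : Seeds n d) :
    ∃ w, IsOptimalWeight Ω X v w := by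
  have hne := hdata.nonempty hΩ
  have hn : 0 < n := Fin.pos_iff_nonempty.2 hne
  set l : Fin n := ⟨n - 1, by omega⟩ with hl
  obtain ⟨C, hC⟩ := exists_bound_weights hΩ hdata X l
  set K : Set (Fin n → ℝ) := {w | w l = 0} ∩ Set.pi univ fun _ => Icc (-|C|) |C| with hK
  have hKc : IsCompact K := (isCompact_univ_pi fun _ => isCompact_Icc).inter_left
    (isClosed_eq (continuous_apply l) continuous_const)
  have h0K : (0 : Fin n → ℝ) ∈ K := ⟨rfl, fun i _ => by simp⟩
  obtain ⟨w, hwK, hw⟩ := hKc.exists_isMaxOn ⟨0, h0K⟩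
    (continuous_dualFunctional (v := v) hΩ X).continuousOn
  refine ⟨w, fun w' => ?_, fun i hi => ?_⟩
  · rw [← dualFunctional_sub_const hΩ hdata X w' (w' l)]
    rcases le_total (dualFunctional Ω X v fun i => w' i - w' l) (dualFunctional Ω X v 0)
      with h | h
    · exact h.trans (hw h0K)
    · refine hw ⟨sub_self _, fun i _ => ?_⟩
      exact abs_le.1 ((hC _ (sub_self _) h i).trans (le_abs_self C))
  · have : i = l := Fin.ext (by simp only [hl]; omega)
    rw [this]
    exact hwK.1

lemma isOptimalWeight_optimalWeight (hΩ : IsDomain Ω) (hdata : IsData Ω v b) (X : Seeds n d) :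
    IsOptimalWeight Ω X v (optimalWeight Ω X v) := by
  have h := exists_isOptimalWeight hΩ hdata X
  rw [optimalWeight, dif_pos h]
  exact h.choose_spec

/-! ### The volumes of the optimal cells -/

lemma isClosed_lagCell (hΩ : IsDomain Ω) (X : Seeds n d) (w : Fin n → ℝ) (i : Fin n) :
    IsClosed (lagCell Ω X w i) := by
  have : lagCell Ω X w i = Ω ∩ ⋂ j, {x | ‖x - X i‖ ^ 2 - w i ≤ ‖x - X j‖ ^ 2 - w j} := by
    ext x; simp [lagCell]
  rw [this]
  exact hΩ.isClosed.inter (isClosed_iInter fun j => isClosed_le (by fun_prop) (by fun_prop))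

lemma lagCell_subset (X : Seeds n d) (w : Fin n → ℝ) (i : Fin n) : lagCell Ω X w i ⊆ Ω :=
  fun _ hx => hx.1

lemma volume_preimage_singleton_eq_zero {f : Pt d →ₗ[ℝ] ℝ} (hf : f ≠ 0) (c : ℝ) :
    volume {x | f x = c} = 0 := by
  set s : AffineSubspace ℝ (Pt d) := (AffineSubspace.mk' c ⊥).comap f.toAffineMap with hs
  have hmem : ∀ x, x ∈ s ↔ f x = c := fun x => by
    simp [hs, AffineSubspace.mem_comap, AffineSubspace.mem_mk', sub_eq_zero]
  have hset : {x | f x = c} = (s : Set (Pt d)) := by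
    ext x; exact (hmem x).symm
  rw [hset]
  refine Measure.addHaar_affineSubspace _ _ fun htop => hf ?_
  have hall : ∀ x, f x = c := fun x => (hmem x).1 (htop ▸ AffineSubspace.mem_top ℝ _ x)
  ext x
  rw [hall x, ← hall 0, map_zero]
  rfl

/-- Two cells with distinct seeds meet in a hyperplane. -/
lemma aedisjoint_lagCell {X : Seeds n d} (hX : X ∈ distinctSeeds n d) (w : Fin n → ℝ) :
    Pairwise (AEDisjoint volume on lagCell Ω X w) := by
  intro i j hij
  set f : Pt d →ₗ[ℝ] ℝ := (innerSL ℝ (X j - X i)).toLinearMap with hf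
  have hf0 : f ≠ 0 := fun h => by
    have h1 : f (X j - X i) = 0 := by rw [h]; rfl
    have h2 : inner ℝ (X j - X i) (X j - X i) = 0 := h1
    exact hX j i hij.symm (sub_eq_zero.1 (inner_self_eq_zero.1 h2))
  refine measure_mono_null ?_ (volume_preimage_singleton_eq_zero hf0
    ((‖X j‖ ^ 2 - ‖X i‖ ^ 2 - w j + w i) / 2))
  rintro x ⟨hx, hx'⟩
  have h1 := le_antisymm (hx.2 j) (hx'.2 i)
  simp only [norm_sub_sq_real] at h1
  have h2 : f x = inner ℝ x (X j) - inner ℝ x (X i) := by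
    rw [← inner_sub_right, real_inner_comm]; rfl
  rw [mem_ofPred_eq, h2]
  linarith

lemma iUnion_lagCell [Nonempty (Fin n)] (X : Seeds n d) (w : Fin n → ℝ) :
    ⋃ i, lagCell Ω X w i = Ω := by
  refine subset_antisymm (iUnion_subset (lagCell_subset X w)) fun x hx => ?_
  obtain ⟨i, hi⟩ := exists_minPower_eq X w x
  exact mem_iUnion.2 ⟨i, mem_lagCell_iff.2 ⟨hx, hi⟩⟩

/-- Raising the `i`-th optimal weight by `h` does not increase the dual functional, whereas the
integrand drops by at most `h`, and only on the enlarged cell. -/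
lemma le_volume_lagCell_update [Nonempty (Fin n)] (hΩ : IsDomain Ω) {X : Seeds n d}
    {w : Fin n → ℝ} (hw : IsOptimalWeight Ω X v w) (i : Fin n) {h : ℝ} (hh : 0 < h) :
    v i ≤ vol (lagCell Ω X (update w i (w i + h)) i) := by
  set w' := update w i (w i + h) with hw'
  set L := lagCell Ω X w' i with hL
  have hLm : MeasurableSet L := (isClosed_lagCell hΩ X w' i).measurableSet
  have hw'i : w' i = w i + h := update_self _ _ _
  have hw'j : ∀ j, j ≠ i → w' j = w j := fun j hj => update_of_ne hj _ _
  have hpt : ∀ x ∈ Ω, minPower X w x - L.indicator (fun _ => h) x ≤ minPower X w' x := by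
    intro x hx
    obtain ⟨j, hj⟩ := exists_minPower_eq X w' x
    have h1 := minPower_le X w x j
    by_cases hji : j = i
    · subst hji
      rw [indicator_of_mem (show x ∈ L from mem_lagCell_iff.2 ⟨hx, hj⟩), ← hj, hw'i]
      linarith
    · have h2 : 0 ≤ L.indicator (fun _ => h) x := indicator_nonneg (fun _ _ => hh.le) x
      rw [← hj, hw'j j hji]
      linarith
  have hIi : IntegrableOn (L.indicator fun _ => h) Ω :=
    (hΩ.integrableOn (continuous_const (y := h))).indicator hLm
  have hint : (∫ x in Ω, minPower X w x) - vol L * h ≤ ∫ x in Ω, minPower X w' x := by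
    have h1 : ∫ x in Ω, L.indicator (fun _ => h) x = vol L * h := by
      rw [setIntegral_indicator hLm, inter_eq_self_of_subset_right (lagCell_subset X w' i),
        setIntegral_const_eq_vol]
    rw [← h1, ← integral_sub (hΩ.integrableOn (continuous_minPower X w)) hIi]
    exact setIntegral_mono_on ((hΩ.integrableOn (continuous_minPower X w)).sub hIi)
      (hΩ.integrableOn (continuous_minPower X w')) hΩ.measurableSet hpt
  have hsum : ∑ j, w' j * v j = (∑ j, w j * v j) + h * v i := by
    rw [← Finset.add_sum_erase _ _ (Finset.mem_univ i),
      ← Finset.add_sum_erase Finset.univ (fun j => w j * v j) (Finset.mem_univ i), hw'i,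
      Finset.sum_congr rfl fun j hj => by rw [hw'j j (Finset.ne_of_mem_erase hj)]]
    ring
  have hopt := hw.1 w'
  rw [dualFunctional_eq, dualFunctional_eq, hsum] at hopt
  have : h * v i ≤ h * vol L := by linarith
  exact le_of_mul_le_mul_left this hh

lemma le_volume_lagCell [Nonempty (Fin n)] (hΩ : IsDomain Ω) {X : Seeds n d}
    {w : Fin n → ℝ} (hw : IsOptimalWeight Ω X v w) (i : Fin n) :
    ENNReal.ofReal (v i) ≤ volume (lagCell Ω X w i) := by
  set L : ℕ → Set (Pt d) := fun k => lagCell Ω X (update w i (w i + 1 / ((k : ℝ) + 1))) i with hL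
  have hmem : ∀ k x, x ∈ L k ↔ x ∈ Ω ∧
      ∀ j, j ≠ i → ‖x - X i‖ ^ 2 - (w i + 1 / ((k : ℝ) + 1)) ≤ ‖x - X j‖ ^ 2 - w j := by
    intro k x
    refine and_congr_right fun _ => ⟨fun h j hj => ?_, fun h j => ?_⟩
    · simpa [hj] using h j
    · by_cases hj : j = i
      · rw [hj]
      · simpa [hj] using h j hj
  have hanti : Antitone L := by
    intro k m hkm x hx
    rw [hmem] at hx ⊢
    refine ⟨hx.1, fun j hj => le_trans ?_ (hx.2 j hj)⟩
    have := Nat.one_div_le_one_div (α := ℝ) hkm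
    linarith
  have hinter : ⋂ k, L k ⊆ lagCell Ω X w i := by
    intro x hx
    rw [mem_iInter] at hx
    refine ⟨((hmem 0 x).1 (hx 0)).1, fun j => ?_⟩
    by_cases hj : j = i
    · rw [hj]
    have ht : Tendsto (fun k : ℕ => ‖x - X i‖ ^ 2 - (w i + 1 / ((k : ℝ) + 1))) atTop
        (𝓝 (‖x - X i‖ ^ 2 - (w i + 0))) :=
      (tendsto_one_div_add_atTop_nhds_zero_nat.const_add _).const_sub _
    rw [add_zero] at ht
    exact le_of_tendsto ht (.of_forall fun k => ((hmem k x).1 (hx k)).2 j hj)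
  have hfin : ∀ k, volume (L k) ≠ ⊤ := fun k =>
    measure_ne_top_of_subset (lagCell_subset X _ i) hΩ.volume_ne_top
  refine le_trans ?_ (measure_mono hinter)
  refine ge_of_tendsto (tendsto_measure_iInter_atTop
    (fun k => (isClosed_lagCell hΩ X _ i).measurableSet.nullMeasurableSet) hanti ⟨0, hfin 0⟩)
    (.of_forall fun k => ?_)
  refine (ENNReal.ofReal_le_iff_le_toReal (hfin k)).2 ?_
  exact le_volume_lagCell_update hΩ hw i (by positivity)

/-- The cells of an optimal diagram have the prescribed volumes: they are at least as large, and
their volumes have the same sum. -/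
lemma isSplit_cell (hΩ : IsDomain Ω) (hdata : IsData Ω v b) {X : Seeds n d}
    (hX : X ∈ distinctSeeds n d) : IsSplit Ω v (cell Ω X v) := by
  have hne := hdata.nonempty hΩ
  have hw := isOptimalWeight_optimalWeight hΩ hdata X
  have hm : ∀ i, MeasurableSet (cell Ω X v i) := fun i => (isClosed_lagCell hΩ X _ i).measurableSet
  have hd : Pairwise (AEDisjoint volume on cell Ω X v) := aedisjoint_lagCell hX _
  have hfin : ∀ i, volume (cell Ω X v i) ≠ ⊤ := fun i =>
    measure_ne_top_of_subset (lagCell_subset X _ i) hΩ.volume_ne_top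
  have hle : ∀ i ∈ Finset.univ, v i ≤ (volume (cell Ω X v i)).toReal := fun i _ =>
    (ENNReal.ofReal_le_iff_le_toReal (hfin i)).1 (le_volume_lagCell hΩ hw i)
  have hsum : ∑ i, v i = ∑ i, (volume (cell Ω X v i)).toReal := by
    have h : ⋃ i, cell Ω X v i = Ω := iUnion_lagCell X _
    rw [hdata.sum_vol, ← ENNReal.toReal_sum fun i _ => hfin i, ← tsum_fintype (L := .unconditional _),
      ← measure_iUnion₀ hd fun i => (hm i).nullMeasurableSet, h, vol]
  refine ⟨hm, fun i => lagCell_subset X _ i, hd, fun i => ?_⟩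
  rw [(Finset.sum_eq_sum_iff_of_le hle).1 hsum i (Finset.mem_univ i),
    ENNReal.ofReal_toReal (hfin i)]

/-! ### The gradient of `H` -/

/-- The vector with entries `v i • (b i - c i)`, where `c i` is the centroid of the `i`-th cell. It
is a supergradient of `H` at `X`, and the gradient if `H` is differentiable there. -/
def momentGap (Ω : Set (Pt d)) (v : Fin n → ℝ) (b X : Seeds n d) : Seeds n d :=
  WithLp.toLp 2 fun i => v i • b i - ∫ x in cell Ω X v i, x

lemma inner_momentGap (X Y : Seeds n d) :
    inner ℝ (momentGap Ω v b X) Y = splitValue v b (cell Ω X v) Y := by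
  rw [real_inner_comm, PiLp.inner_apply]
  rfl

lemma fitError_eq (hΩ : IsDomain Ω) (hdata : IsData Ω v b) {X : Seeds n d}
    (hX : X ∈ distinctSeeds n d) : fitError Ω v b X = ‖momentGap Ω v b X‖ ^ 2 := by
  rw [PiLp.norm_sq_eq_of_L2, fitError]
  refine Finset.sum_congr rfl fun i _ => ?_
  have hv : vol (cell Ω X v i) = v i := (isSplit_cell hΩ hdata hX).measureReal_eq hdata i
  have h : momentGap Ω v b X i = v i • (b i - cellCentroid Ω X v i) := by
    rw [cellCentroid, centroid, hv, smul_sub, smul_inv_smul₀ (hdata.pos i).ne']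
    rfl
  rw [h, norm_smul, mul_pow, Real.norm_eq_abs, sq_abs, norm_sub_rev]

/-- The supergradient inequality; there is no affine term, since `H` is positively homogeneous. -/
lemma H_le_inner_momentGap (hΩ : IsDomain Ω) (hdata : IsData Ω v b) {X : Seeds n d}
    (hX : X ∈ distinctSeeds n d) (Y : Seeds n d) :
    H Ω v b Y ≤ inner ℝ (momentGap Ω v b X) Y := by
  rw [inner_momentGap]
  exact H_le_splitValue hΩ hdata (isSplit_cell hΩ hdata hX) Y

/-- Among all splittings, the optimal Laguerre diagram has the smallest transport cost: its cells
consist of the points where the power distance to the seed is minimal. -/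
lemma splitValue_cell_le (hΩ : IsDomain Ω) (hdata : IsData Ω v b) {X : Seeds n d}
    (hX : X ∈ distinctSeeds n d) {B : Fin n → Set (Pt d)} (hB : IsSplit Ω v B) :
    splitValue v b (cell Ω X v) X ≤ splitValue v b B X := by
  have hne := hdata.nonempty hΩ
  set w := optimalWeight Ω X v
  have hC := isSplit_cell hΩ hdata hX
  have hsplit : ∀ {A : Fin n → Set (Pt d)}, IsSplit Ω v A → ∀ i,
      ∫ x in A i, (‖x - X i‖ ^ 2 - w i) = (∫ x in A i, ‖x - X i‖ ^ 2) - v i * w i := by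
    intro A hA i
    have hfin : IsFiniteMeasure (volume.restrict (A i)) := ⟨by simp [hA.volume_eq]⟩
    rw [integral_sub ((hΩ.integrableOn (by fun_prop)).mono_set (hA.subset i))
      (integrable_const _), setIntegral_const, hA.measureReal_eq hdata, smul_eq_mul]
  have hmin : IntegrableOn (minPower X w) Ω := hΩ.integrableOn (continuous_minPower X w)
  have h1 : ∑ i, ∫ x in cell Ω X v i, (‖x - X i‖ ^ 2 - w i) = ∫ x in Ω, minPower X w x := by
    rw [hC.integral_eq hΩ hdata hmin]
    exact Finset.sum_congr rfl fun i _ => setIntegral_congr_fun (hC.measurableSet i)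
      fun x hx => (mem_lagCell_iff.1 hx).2
  have h2 : ∫ x in Ω, minPower X w x ≤ ∑ i, ∫ x in B i, (‖x - X i‖ ^ 2 - w i) := by
    rw [hB.integral_eq hΩ hdata hmin]
    refine Finset.sum_le_sum fun i _ => setIntegral_mono (hmin.mono_set (hB.subset i))
      ((hΩ.integrableOn (by fun_prop)).mono_set (hB.subset i)) fun x => minPower_le X w x i
  simp only [hsplit hB, Finset.sum_sub_distrib] at h2
  simp only [hsplit hC, Finset.sum_sub_distrib] at h1
  have h3 := sum_integral_eq hΩ hdata hB X
  have h4 := sum_integral_eq hΩ hdata hC X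
  simp only [splitValue, inner_sub_right, Finset.sum_sub_distrib]
  linarith

lemma H_eq_inner_momentGap (hd : 0 < d) (hΩ : IsDomain Ω) (hdata : IsData Ω v b) {X : Seeds n d}
    (hX : X ∈ distinctSeeds n d) : H Ω v b X = inner ℝ (momentGap Ω v b X) X := by
  refine le_antisymm (H_le_inner_momentGap hΩ hdata hX X) ?_
  rw [inner_momentGap]
  exact le_H_of_forall_le_splitValue hd hΩ hdata fun B hB => splitValue_cell_le hΩ hdata hX hB

lemma hasFDerivAt_H (hd : 0 < d) (hΩ : IsDomain Ω) (hdata : IsData Ω v b) {X : Seeds n d}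
    (hX : X ∈ distinctSeeds n d) (hdiff : DifferentiableAt ℝ (H Ω v b) X) :
    HasFDerivAt (H Ω v b) (innerSL ℝ (momentGap Ω v b X)) X := by
  have hlin := (innerSL ℝ (momentGap Ω v b X)).hasFDerivAt (x := X)
  -- `⟪momentGap, ·⟫ - H` is non-negative and vanishes at `X`
  have hmin : IsLocalMin (fun Y => innerSL ℝ (momentGap Ω v b X) Y - H Ω v b Y) X := by
    refine .of_forall fun Y => ?_
    simp only [innerSL_apply_apply, ← H_eq_inner_momentGap hd hΩ hdata hX, sub_self]
    exact sub_nonneg.2 (H_le_inner_momentGap hΩ hdata hX Y)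
  have h := hmin.hasFDerivAt_eq_zero (hlin.sub hdiff.hasFDerivAt)
  rw [sub_eq_zero.1 h]
  exact hdiff.hasFDerivAt

/-- Prescribed and actual first moments have the same sum, so `H` is invariant under
translations. -/
lemma inner_momentGap_diag (hΩ : IsDomain Ω) (hdata : IsData Ω v b) {X : Seeds n d}
    (hX : X ∈ distinctSeeds n d) (t : Pt d) :
    inner ℝ (momentGap Ω v b X) (diag n t) = 0 := by
  have h : splitValue v b (cell Ω X v) (diag n t) =
      inner ℝ t (∑ i, (v i • b i - ∫ x in cell Ω X v i, x)) := by
    rw [inner_sum]; rfl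
  rw [inner_momentGap, h, Finset.sum_sub_distrib, hdata.sum_moment,
    ← (isSplit_cell hΩ hdata hX).integral_eq hΩ hdata (hΩ.integrableOn continuous_id'), centroid,
    smul_inv_smul₀ hΩ.vol_pos.ne', sub_self, inner_zero_right]

/-! ### Maximisers of `H` on a ball -/

/-- At a maximiser on a ball the gradient, if non-zero, points to the maximiser from the centre. -/
lemma mul_norm_momentGap_le (hd : 0 < d) (hΩ : IsDomain Ω) (hdata : IsData Ω v b)
    {X T : Seeds n d} {R : ℝ} (hR : 0 < R) (hX : X ∈ distinctSeeds n d)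
    (hdiff : DifferentiableAt ℝ (H Ω v b) X) (hXB : X ∈ Metric.closedBall T R)
    (hmax : IsMaxOn (H Ω v b) (Metric.closedBall T R) X) :
    R * ‖momentGap Ω v b X‖ ≤ inner ℝ (momentGap Ω v b X) (X - T) := by
  set G := momentGap Ω v b X with hG
  by_cases hG0 : G = 0
  · simp [hG0]
  have hGn : 0 < ‖G‖ := norm_pos_iff.2 hG0
  -- the point of the ball that is extreme in the direction of the gradient
  set Y := T + (R / ‖G‖) • G with hY
  have hYB : Y ∈ Metric.closedBall T R := by
    rw [hY, mem_closedBall_iff_norm, add_sub_cancel_left, norm_smul, norm_div, norm_norm,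
      Real.norm_of_nonneg hR.le, div_mul_cancel₀ _ hGn.ne']
  have hle := hmax.localize.hasFDerivWithinAt_nonpos
    (hasFDerivAt_H hd hΩ hdata hX hdiff).hasFDerivWithinAt
    (sub_mem_posTangentConeAt_of_segment_subset
      ((convex_closedBall T R).segment_subset hXB hYB))
  have h1 : Y - X = (R / ‖G‖) • G - (X - T) := by rw [hY]; abel
  rw [innerSL_apply_apply, ← hG, h1, inner_sub_right, inner_smul_right,
    real_inner_self_eq_norm_sq, pow_two, ← mul_assoc, div_mul_cancel₀ _ hGn.ne'] at hle
  linarith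

/-- A maximiser of `H` on a ball minimises the fit error among all lists of distinct seeds. -/
lemma fitError_le_of_isMaxOn (hd : 0 < d) (hΩ : IsDomain Ω) (hdata : IsData Ω v b)
    {X Y : Seeds n d} {t : Pt d} {R : ℝ} (hR : 0 < R) (hX : X ∈ distinctSeeds n d)
    (hdiff : DifferentiableAt ℝ (H Ω v b) X) (hXB : X ∈ Metric.closedBall (diag n t) R)
    (hmax : IsMaxOn (H Ω v b) (Metric.closedBall (diag n t) R) X) (hY : Y ∈ distinctSeeds n d) :
    fitError Ω v b X ≤ fitError Ω v b Y := by
  rw [fitError_eq hΩ hdata hX, fitError_eq hΩ hdata hY]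
  refine pow_le_pow_left₀ (norm_nonneg _) (le_of_mul_le_mul_left ?_ hR) 2
  calc R * ‖momentGap Ω v b X‖ ≤ inner ℝ (momentGap Ω v b X) (X - diag n t) :=
        mul_norm_momentGap_le hd hΩ hdata hR hX hdiff hXB hmax
    _ = H Ω v b X := by
        rw [inner_sub_right, inner_momentGap_diag hΩ hdata hX, sub_zero,
          H_eq_inner_momentGap hd hΩ hdata hX]
    _ ≤ inner ℝ (momentGap Ω v b Y) X := H_le_inner_momentGap hΩ hdata hY X
    _ = inner ℝ (momentGap Ω v b Y) (X - diag n t) := by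
        rw [inner_sub_right, inner_momentGap_diag hΩ hdata hY, sub_zero]
    _ ≤ ‖momentGap Ω v b Y‖ * ‖X - diag n t‖ := real_inner_le_norm _ _
    _ ≤ ‖momentGap Ω v b Y‖ * R := by gcongr; exact mem_closedBall_iff_norm.1 hXB
    _ = R * ‖momentGap Ω v b Y‖ := mul_comm _ _

end LaguerreFit

end

theorem theorem4p7 (n d : ℕ) (hd : 2 ≤ d)
    (Ω : Set (LaguerreFit.Pt d)) (hΩ : LaguerreFit.IsDomain Ω)
    (v : Fin n → ℝ) (b : LaguerreFit.Seeds n d) (hdata : LaguerreFit.IsData Ω v b)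
    (hnot : ¬ ∃ X : LaguerreFit.Seeds n d, LaguerreFit.IsCompatible Ω v b X)
    (t : LaguerreFit.Pt d) (R : ℝ) (hR : 0 < R)
    (X : LaguerreFit.Seeds n d)
    (hXB : X ∈ Metric.closedBall (LaguerreFit.diag n t) R)
    (hmax : IsMaxOn (LaguerreFit.H Ω v b) (Metric.closedBall (LaguerreFit.diag n t) R) X)
    (hX : X ∈ LaguerreFit.distinctSeeds n d)
    (hC3 : ∃ U : Set (LaguerreFit.Seeds n d), IsOpen U ∧ X ∈ U ∧
      ContDiffOn ℝ 3 (LaguerreFit.H Ω v b) U)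
    (hker : Module.finrank ℝ
      (LinearMap.ker (LaguerreFit.hessian (LaguerreFit.H Ω v b) X).toLinearMap) = 1 + d) :
    ConcaveOn ℝ Set.univ (LaguerreFit.H Ω v b) ∧
      IsLocalMinOn (LaguerreFit.fitError Ω v b) (LaguerreFit.distinctSeeds n d) X := by
  have hd0 : 0 < d := by omega
  refine ⟨LaguerreFit.concaveOn_H hd0 hΩ hdata, ?_⟩
  obtain ⟨U, hU, hXU, hUC⟩ := hC3
  have hdiff : DifferentiableAt ℝ (LaguerreFit.H Ω v b) X :=
    (hUC.contDiffAt (hU.mem_nhds hXU)).differentiableAt (by norm_num)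
  filter_upwards [self_mem_nhdsWithin] with Y hY
  exact LaguerreFit.fitError_le_of_isMaxOn hd0 hΩ hdata hR hX hdiff hXB hmax hY
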